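/- A \emph{difference--restriction algebra} is a nonempty algebra $A$ with two binary operations $-,\rhd$ that is isomorphic to an algebra of partial functions from a set $X$ to a set $Y$, where $f-g$ is the difference of the graphs and $f\rhd g$ is the restriction of $g$ to the domain of $f$. Put $a\cdot b:=a-(a-b)$ and $a\le b:\iff a\cdot b=a$; this is a meet-semilattice order. Let $\mathbf{DRA}$ be the category of these algebras and their homomorphisms. Elements $a,b$ are \emph{compatible} if $a\rhd b=b\rhd a$, and $A$ is \emph{finitarily compatibly complete} if every finite set of pairwise compatible elements has a join. A \emph{Hausdorff \'etale space} is a surjective local homeomorphism $\pi\colon X\to X_0$ with $X$ and $X_0$ Hausdorff. A morphism from $\pi\colon X\to X_0$ to $\rho\colon Y\to Y_0$ is a partial function $\varphi\colon X\rightharpoonup Y$ such that preimages of open sets are open, preimages of compact sets are compact, and: (1) if $\varphi(x),\varphi(x')$ are defined and $\pi(x)=\pi(x')$, then $\rho(\varphi(x))=\rho(\varphi(x'))$; (2) if moreover $\varphi(x)=\varphi(x')$, then $x=x'$; (3) if $\varphi(x)$ is defined and $\rho(y)=\rho(\varphi(x))$, then there is $x'$ with $\pi(x')=\pi(x)$ and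 $\varphi(x')=y$. This gives a category $\mathbf{HausEt}$. Let $F\colon\mathbf{DRA}\to\mathbf{HausEt}^{\mathrm{op}}$ send $A$ to the quotient map from its space of maximal proper filters, with the topology generated by the sets $\widehat a=\{\mu\mid a\in\mu\}$, onto the quotient space by the equivalence relation $\mu\approx\nu\iff(\forall a\in\mu)(\forall b\in\nu)\ a\rhd b\in\nu$, and send $h\colon A\to B$ to the partial function $\xi\mapsto h^{-1}(\xi)$, defined for those maximal filters $\xi$ of $B$ that meet $h[A]$. Let $G\colon\mathbf{HausEt}^{\mathrm{op}}\to\mathbf{DRA}$ send $\pi\colon X\to X_0$ to the algebra of all compact open $U\subseteq X$ on which $\pi$ is injective, with $U-V=U\setminus V$ and $U\rhd V=\pi^{-1}(\pi(U))\cap V$, and send $\varphi$ to $U\mapsto\varphi^{-1}(U)$. \textbf{Proposition.} $F$ is left adjoint to $G$, with unit $a\mapsto\widehat a$ and with counit given by the partial functions $x\mapsto\{U\in G(\pi)\mid x\in U\}$, defined where this set is nonempty. This adjunction restricts to a duality (a dual equivalence) between the full subcategory of $\mathbf{DRA}$ on the finitarily compatibly complete algebras and the full subcategory of $\mathbf{HausEt}$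 on the $\pi\colon X\to X_0$ for which $X$ is locally compact and zero-dimensional (every point of $X$ has a neighbourhood basis of compact sets, and one of clopen sets): $F$ and $G$ map each of these subcategories into the other, and there the unit and the counit are isomorphisms. -/

import Mathlib

open CategoryTheory

universe u v w

/-- An algebra of the signature `{-, ▷}`: two binary operations without any laws. -/
class DiffRest (A : Type u) where
  /-- the operation `a - b` -/
  diff : A → A → A
  /-- the operation `a ▷ b` -/
  rest : A → A → A

namespace DiffRest

variable {A : Type u} [DiffRest A]

/-- The derived operation `a · b = a - (a - b)`. -/
def meet (a b : A) : A := diff a (diff a b)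

/-- A representation of a `{-, ▷}`-algebra: an isomorphism onto an algebra of partial functions from
`X` to `Y`, in which `-` is the relative complement of graphs, and `f ▷ g` is the restriction of
`g` to the domain of `f`. -/
structure IsRepresentation {X : Type v} {Y : Type w} (θ : A → (X →. Y)) : Prop where
  injective : Function.Injective θ
  map_diff : ∀ (a b : A) (x : X) (y : Y), y ∈ θ (diff a b) x ↔ y ∈ θ a x ∧ y ∉ θ b x
  map_rest : ∀ (a b : A) (x : X) (y : Y), y ∈ θ (rest a b) x ↔ x ∈ (θ a).Dom ∧ y ∈ θ b x

end DiffRest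

open DiffRest

/-- A difference–restriction algebra: a nonempty `{-, ▷}`-algebra that is isomorphic to an algebra
of partial functions. -/
structure DRA : Type (u + 1) where
  carrier : Type u
  [ops : DiffRest carrier]
  nonempty : Nonempty carrier
  representable : ∃ (X Y : Type u) (θ : carrier → (X →. Y)), IsRepresentation θ

namespace DRA

instance : CoeSort DRA.{u} (Type u) := ⟨DRA.carrier⟩

instance (A : DRA.{u}) : DiffRest A := A.ops

/-- Homomorphisms of `{-, ▷}`-algebras. -/
@[ext]
structure Hom (A B : DRA.{u}) where
  toFun : A → B
  map_diff : ∀ a b : A, toFun (diff a b) = diff (toFun a) (toFun b)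
  map_rest : ∀ a b : A, toFun (rest a b) = rest (toFun a) (toFun b)

/-- The category of difference–restriction algebras. -/
instance : Category DRA.{u} where
  Hom A B := Hom A B
  id A := ⟨fun a => a, fun _ _ => rfl, fun _ _ => rfl⟩
  comp f g := ⟨fun a => g.toFun (f.toFun a), fun a b => by rw [f.map_diff, g.map_diff],
    fun a b => by rw [f.map_rest, g.map_rest]⟩

/-- The order of the meet-semilattice `(A, ·)`: `a ≤ b` if `a · b = a`. -/
instance (A : DRA.{u}) : LE A := ⟨fun a b => meet a b = a⟩

variable {A B : DRA.{u}}

/-- A representation, written with relations. -/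
theorem exists_rel (A : DRA.{u}) : ∃ (X Y : Type u) (r : A → X → Y → Prop),
    (∀ a b, (∀ x y, r a x y ↔ r b x y) → a = b) ∧
    (∀ a x y z, r a x y → r a x z → y = z) ∧
    (∀ a b x y, r (diff a b) x y ↔ r a x y ∧ ¬ r b x y) ∧
    (∀ a b x y, r (rest a b) x y ↔ (∃ z, r a x z) ∧ r b x y) ∧
    (∀ a b x y, r (meet a b) x y ↔ r a x y ∧ r b x y) ∧
    (∀ a b, a ≤ b ↔ ∀ x y, r a x y → r b x y) := by
  obtain ⟨X, Y, θ, hθ⟩ := A.representable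
  have inj : ∀ a b : A, (∀ x y, y ∈ θ a x ↔ y ∈ θ b x) → a = b :=
    fun a b h => hθ.injective (PFun.ext h)
  have hm : ∀ (a b : A) x y, y ∈ θ (meet a b) x ↔ y ∈ θ a x ∧ y ∈ θ b x := by
    intro a b x y
    simp only [meet, hθ.map_diff]
    tauto
  refine ⟨X, Y, fun a x y => y ∈ θ a x, inj, fun a x y z => Part.mem_unique, hθ.map_diff,
    fun a b x y => (hθ.map_rest a b x y).trans (and_congr_left' (PFun.mem_dom _ _)), hm, fun a b => ⟨fun h x y hy => ?_, fun h => ?_⟩⟩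
  · have h' : meet a b = a := h
    rw [← h', hm] at hy
    exact hy.2
  · exact inj _ _ fun x y => by rw [hm]; exact ⟨fun h => h.1, fun hy => ⟨hy, h x y hy⟩⟩

theorem Hom.map_meet (h : Hom A B) (a b : A) : h.toFun (meet a b) = meet (h.toFun a) (h.toFun b) := by
  simp only [meet, h.map_diff]

theorem Hom.mono (h : Hom A B) {a b : A} (hab : a ≤ b) : h.toFun a ≤ h.toFun b := by
  have hab' : meet a b = a := hab
  change meet _ _ = _
  rw [← h.map_meet, hab']

theorem diff_self_le (a b : A) : diff a a ≤ b := by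
  obtain ⟨X, Y, r, inj, fn, hd, hr, hm, hl⟩ := A.exists_rel
  rw [hl]; intro x y; rw [hd]; tauto

/-- Filters of the meet-semilattice `A`. -/
structure IsFilter (F : Set A) : Prop where
  nonempty : F.Nonempty
  up : ∀ a b : A, a ∈ F → a ≤ b → b ∈ F
  meet_mem : ∀ a b : A, a ∈ F → b ∈ F → meet a b ∈ F

variable (A) in
/-- The set of maximal filters of `A`: filters that are maximal among the proper filters. -/
@[ext]
structure MaxFilter : Type u where
  carrier : Set A
  maximal : Maximal (fun F : Set A => IsFilter F ∧ F ≠ Set.univ) carrier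

instance : SetLike (MaxFilter A) A := ⟨MaxFilter.carrier, fun _ _ => MaxFilter.ext⟩

theorem MaxFilter.isFilter (μ : MaxFilter A) : IsFilter (μ : Set A) := μ.maximal.1.1

theorem MaxFilter.up (μ : MaxFilter A) {a b : A} (ha : a ∈ μ) (h : a ≤ b) : b ∈ μ :=
  μ.isFilter.up a b ha h

theorem MaxFilter.meet_mem (μ : MaxFilter A) {a b : A} (ha : a ∈ μ) (hb : b ∈ μ) : meet a b ∈ μ :=
  μ.isFilter.meet_mem a b ha hb

theorem MaxFilter.diff_self_notMem (μ : MaxFilter A) (a : A) : diff a a ∉ μ := fun h =>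
  μ.maximal.1.2 (Set.eq_univ_of_forall fun b => μ.up h (diff_self_le a b))

theorem MaxFilter.meet_or_diff (μ : MaxFilter A) {a : A} (ha : a ∈ μ) (b : A) :
    meet a b ∈ μ ∨ diff a b ∈ μ := by
  by_contra! hcon
  obtain ⟨X, Y, r, inj, fn, hd, hr, hm, hl⟩ := A.exists_rel
  let F : Set A := {c | ∃ f ∈ μ, diff f b ≤ c}
  have hμF : (μ : Set A) ⊆ F := fun c hc => ⟨c, hc, by rw [hl]; intro x y; rw [hd]; tauto⟩
  have hF : IsFilter F := by
    refine ⟨⟨a, hμF ha⟩, ?_, ?_⟩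
    · rintro c d ⟨f, hf, hfc⟩ hcd
      refine ⟨f, hf, ?_⟩
      rw [hl] at *
      exact fun x y h => hcd x y (hfc x y h)
    · rintro c d ⟨f, hf, hfc⟩ ⟨g, hg, hgd⟩
      refine ⟨meet f g, μ.meet_mem hf hg, ?_⟩
      rw [hl] at *
      intro x y
      have h1 := hfc x y
      have h2 := hgd x y
      rw [hd] at *
      simp only [hm]
      tauto
  have hF' : F ≠ Set.univ := by
    intro h
    obtain ⟨f, hf, hf0⟩ : diff a a ∈ F := h ▸ Set.mem_univ _
    refine hcon.1 (μ.up (μ.meet_mem ha hf) ?_)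
    rw [hl] at *
    intro x y
    have h1 := hf0 x y
    simp only [hm, hd] at *
    tauto
  have := μ.maximal.2 ⟨hF, hF'⟩ hμF
  exact hcon.2 (this ⟨a, ha, by rw [hl]; exact fun x y h => h⟩)

theorem MaxFilter.not_both (μ : MaxFilter A) (a b : A) : ¬ (meet a b ∈ μ ∧ diff a b ∈ μ) := by
  rintro ⟨h1, h2⟩
  refine μ.diff_self_notMem a (μ.up (μ.meet_mem h1 h2) ?_)
  obtain ⟨X, Y, r, inj, fn, hd, hr, hm, hl⟩ := A.exists_rel
  rw [hl]; intro x y; simp only [hm, hd]; tauto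

theorem maximal_of_split {F : Set A} (hF : IsFilter F)
    (h : ∀ a ∈ F, ∀ b, meet a b ∈ F ∨ diff a b ∈ F) (h0 : ∀ a : A, diff a a ∉ F) :
    Maximal (fun F : Set A => IsFilter F ∧ F ≠ Set.univ) F := by
  obtain ⟨X, Y, r, inj, fn, hd, hr, hm, hl⟩ := A.exists_rel
  obtain ⟨a, ha⟩ := hF.nonempty
  refine ⟨⟨hF, fun h => h0 a (h ▸ Set.mem_univ _)⟩, ?_⟩
  rintro G ⟨hG, hGu⟩ hFG b hb
  rcases h a ha b with h1 | h1
  · exact hF.up _ _ h1 (by rw [hl]; intro x y; rw [hm]; tauto)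
  · refine absurd (Set.eq_univ_of_forall fun c => ?_) hGu
    refine hG.up _ _ (hG.meet_mem _ _ hb (hFG h1)) ?_
    rw [hl]; intro x y; simp only [hm, hd]; tauto

theorem MaxFilter.eq_of_le {μ ν : MaxFilter A} (h : ∀ a ∈ μ, a ∈ ν) : μ = ν :=
  SetLike.coe_injective (Set.Subset.antisymm h (μ.maximal.2 ν.maximal.1 h))

/-- The set `â` of the maximal filters that contain `a`. -/
def hat (a : A) : Set (MaxFilter A) := {μ | a ∈ μ}

/-- The topology generated by the sets `â`. -/
instance : TopologicalSpace (MaxFilter A) := TopologicalSpace.generateFrom (Set.range hat)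

theorem hat_meet (a b : A) : hat (meet a b) = hat a ∩ hat b := by
  obtain ⟨X, Y, r, inj, fn, hd, hr, hm, hl⟩ := A.exists_rel
  ext μ
  refine ⟨fun h => ⟨μ.up h ?_, μ.up h ?_⟩, fun h => μ.meet_mem h.1 h.2⟩ <;>
  · rw [hl]; intro x y; rw [hm]; tauto

theorem isBasis_hat : TopologicalSpace.IsTopologicalBasis (Set.range (hat (A := A))) where
  exists_subset_inter := by
    rintro _ ⟨a, rfl⟩ _ ⟨b, rfl⟩ μ hμ
    exact ⟨hat (meet a b), ⟨_, rfl⟩, by rwa [hat_meet], by rw [hat_meet]⟩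
  sUnion_eq := Set.eq_univ_of_forall fun μ => by
    obtain ⟨a, ha⟩ := μ.isFilter.nonempty
    exact ⟨hat a, ⟨a, rfl⟩, ha⟩
  eq_generateFrom := rfl

theorem isOpen_hat (a : A) : IsOpen (hat a) := isBasis_hat.isOpen ⟨a, rfl⟩

theorem isCompact_hat (a : A) : IsCompact (hat a) := by
  obtain ⟨X, Y, r, inj, fn, hd, hr, hm, hl⟩ := A.exists_rel
  rw [isCompact_iff_ultrafilter_le_nhds]
  intro U hU
  have hUa : hat a ∈ U := by simpa using hU
  let F : Set A := {b | hat b ∈ U}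
  have hF : IsFilter F := by
    refine ⟨⟨a, hUa⟩, fun b c hb hbc => ?_, fun b c hb hc => ?_⟩
    · exact Filter.mem_of_superset hb fun μ hμ => μ.up hμ hbc
    · change hat _ ∈ U
      rw [hat_meet]
      exact Filter.inter_mem hb hc
  have hmax := maximal_of_split hF (fun b hb c => by
    have : hat b ⊆ hat (meet b c) ∪ hat (diff b c) := fun μ hμ => μ.meet_or_diff hμ c
    exact Ultrafilter.union_mem_iff.1 (Filter.mem_of_superset hb this)) (fun b hb => by
    obtain ⟨μ, hμ⟩ := Ultrafilter.nonempty_of_mem hb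
    exact μ.diff_self_notMem b hμ)
  refine ⟨⟨F, hmax⟩, hUa, ?_⟩
  rw [(isBasis_hat.nhds_hasBasis).ge_iff]
  rintro _ ⟨⟨b, rfl⟩, hb⟩
  exact hb

instance : T2Space (MaxFilter A) := by
  refine ⟨fun μ ν hne => ?_⟩
  obtain ⟨a, ha, hb⟩ : ∃ a ∈ μ, a ∉ ν := by
    by_contra! h
    exact hne (MaxFilter.eq_of_le h)
  obtain ⟨b, hbν⟩ := ν.isFilter.nonempty
  have h1 : diff b a ∈ ν := by
    refine (ν.meet_or_diff hbν a).resolve_left fun h => hb ?_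
    have : ν ∈ hat b ∩ hat a := hat_meet b a ▸ h
    exact this.2
  refine ⟨hat a, hat (diff b a), isOpen_hat _, isOpen_hat _, ha, h1, ?_⟩
  rw [Set.disjoint_left]
  intro ξ h2 h3
  obtain ⟨X, Y, r, inj, fn, hd, hr, hm, hl⟩ := A.exists_rel
  refine ξ.diff_self_notMem a (ξ.up (ξ.meet_mem h2 h3) ?_)
  rw [hl]; intro x y; simp only [hm, hd]; tauto

theorem rest_split (μ : MaxFilter A) {b : A} (hb : b ∈ μ) (a : A) (h : rest a b ∉ μ) :
    diff b (rest a b) ∈ μ := by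
  obtain ⟨X, Y, r, inj, fn, hd, hr, hm, hl⟩ := A.exists_rel
  refine (μ.meet_or_diff hb _).resolve_left fun h' => h (μ.up h' ?_)
  rw [hl]; intro x y; simp only [hm]; tauto

variable (A) in
/-- The equivalence relation `≈` on maximal filters: `μ ≈ ν` if `a ▷ b ∈ ν` for all `a ∈ μ` and
`b ∈ ν`. (By symmetry, then also `b ▷ a ∈ μ`.) -/
instance maxFilterSetoid : Setoid (MaxFilter A) where
  r μ ν := ∀ a ∈ μ, ∀ b ∈ ν, rest a b ∈ ν
  iseqv := by
    obtain ⟨X, Y, r, inj, fn, hd, hr, hm, hl⟩ := A.exists_rel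
    refine ⟨?_, ?_, ?_⟩
    · intro μ a ha b hb
      refine μ.up (μ.meet_mem ha hb) ?_
      rw [hl]; intro x y; simp only [hm, hr]; exact fun h => ⟨⟨y, h.1⟩, h.2⟩
    · intro μ ν h b hb a ha
      by_contra hcon
      refine ν.diff_self_notMem a (ν.up (h _ (rest_split μ ha b hcon) b hb) ?_)
      rw [hl]; intro x y; simp only [hr, hd]; rintro ⟨⟨z, h1, h2⟩, h3⟩
      exact absurd ⟨⟨_, h3⟩, h1⟩ h2
    · intro μ ν ξ h1 h2 a ha c hc
      obtain ⟨b, hb⟩ := ν.isFilter.nonempty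
      refine ξ.up (h2 _ (h1 a ha b hb) c hc) ?_
      rw [hl]; intro x y; simp only [hr]; rintro ⟨⟨z, h1, h2⟩, h3⟩
      exact ⟨h1, h3⟩

theorem equiv_iff {μ ν : MaxFilter A} : μ ≈ ν ↔ ∀ a ∈ μ, ∀ b ∈ ν, rest a b ∈ ν := Iff.rfl

theorem exists_equiv (ξ : MaxFilter A) {M : Set A} (hne : M.Nonempty)
    (hmeet : ∀ m ∈ M, ∀ n ∈ M, meet m n ∈ M) (hM : ∀ m ∈ M, ∀ e ∈ ξ, rest m e ∈ ξ) :
    ∃ ν : MaxFilter A, (∀ m ∈ M, m ∈ ν) ∧ ν ≈ ξ := by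
  obtain ⟨X, Y, r, inj, fn, hd, hr, hm, hl⟩ := A.exists_rel
  obtain ⟨e₀, he₀⟩ := ξ.isFilter.nonempty
  let G : Set A := {c | ∃ m ∈ M, ∃ e ∈ ξ, rest e m ≤ c}
  have hG : IsFilter G := by
    obtain ⟨m, hmM⟩ := hne
    refine ⟨⟨_, m, hmM, e₀, he₀, (hl _ _).2 fun x y h => h⟩, ?_, ?_⟩
    · rintro b c ⟨m, hmM, e, he, hb⟩ hbc
      refine ⟨m, hmM, e, he, ?_⟩
      rw [hl] at *
      exact fun x y h => hbc x y (hb x y h)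
    · rintro b c ⟨m, hmM, e, he, hb⟩ ⟨n, hn, f, hf, hc⟩
      refine ⟨meet m n, hmeet m hmM n hn, meet e f, ξ.meet_mem he hf, ?_⟩
      rw [hl] at *
      simp only [hr, hm] at *
      rintro x y ⟨⟨z, hz1, hz2⟩, h1, h2⟩
      exact ⟨hb x y ⟨⟨z, hz1⟩, h1⟩, hc x y ⟨⟨z, hz2⟩, h2⟩⟩
  have hmax := maximal_of_split hG (by
    rintro b ⟨m, hmM, e, he, hb⟩ c
    have he' := hM m hmM e he
    rw [hl] at hb
    rcases ξ.meet_or_diff he' (rest (meet m c) (rest m e)) with h | h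
    · refine Or.inl ⟨m, hmM, _, h, ?_⟩
      rw [hl]
      simp only [hr, hm] at *
      rintro x y ⟨⟨z, ⟨_, hz⟩, ⟨⟨w, hw1, hw2⟩, _⟩⟩, h2⟩
      obtain rfl := fn _ _ _ _ hw1 h2
      exact ⟨hb x w ⟨⟨z, hz⟩, h2⟩, hw2⟩
    · refine Or.inr ⟨m, hmM, _, h, ?_⟩
      rw [hl]
      simp only [hr, hm, hd] at *
      rintro x y ⟨⟨z, hz, hz'⟩, h2⟩
      exact ⟨hb x y ⟨⟨z, hz.2⟩, h2⟩, fun h3 => hz' ⟨⟨y, h2, h3⟩, hz⟩⟩) (by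
    rintro a ⟨m, hmM, e, he, h0⟩
    refine ξ.diff_self_notMem a (ξ.up (hM m hmM e he) ?_)
    rw [hl] at *
    simp only [hr, hd] at *
    rintro x y ⟨⟨z, hz⟩, h2⟩
    have := h0 x z ⟨⟨y, h2⟩, hz⟩
    tauto)
  refine ⟨⟨G, hmax⟩, fun m hmM => ⟨m, hmM, e₀, he₀, ?_⟩, Setoid.symm ?_⟩
  · rw [hl]
    intro x y
    rw [hr]
    tauto
  · rintro e he c ⟨m, hmM, f, hf, hc⟩
    refine ⟨m, hmM, meet e f, ξ.meet_mem he hf, ?_⟩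
    rw [hl] at *
    simp only [hr, hm] at *
    rintro x y ⟨⟨z, hz1, hz2⟩, h1⟩
    exact ⟨⟨z, hz1⟩, hc x y ⟨⟨z, hz2⟩, h1⟩⟩

theorem isOpenMap_mk : IsOpenMap (Quotient.mk (maxFilterSetoid A)) := by
  rw [isBasis_hat.isOpenMap_iff]
  rintro _ ⟨a, rfl⟩
  rw [← isQuotientMap_quotient_mk'.isOpen_preimage, isBasis_hat.isOpen_iff]
  rintro ν ⟨μ, hμ, hμν⟩
  obtain ⟨b, hb⟩ := ν.isFilter.nonempty
  have hμν : μ ≈ ν := Quotient.exact hμν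
  refine ⟨_, ⟨rest a b, rfl⟩, hμν a hμ b hb, fun ξ (hξ : rest a b ∈ ξ) => ?_⟩
  obtain ⟨X, Y, r, inj, fn, hd, hr, hm, hl⟩ := A.exists_rel
  obtain ⟨ν', h1, h2⟩ := exists_equiv ξ (M := {a}) ⟨a, rfl⟩
    (by
      rintro _ rfl _ rfl
      exact inj _ _ fun x y => by rw [hm, and_self])
    (by
      rintro _ rfl e he
      refine ξ.up (ξ.meet_mem hξ he) ?_
      rw [hl]; intro x y; simp only [hm, hr]; tauto)
  exact ⟨ν', h1 a rfl, Quotient.sound h2⟩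

theorem injOn_mk_hat (a : A) : Set.InjOn (Quotient.mk (maxFilterSetoid A)) (hat a) := by
  intro μ hμ ν hν h
  have h : μ ≈ ν := Quotient.exact h
  obtain ⟨X, Y, r, inj, fn, hd, hr, hm, hl⟩ := A.exists_rel
  refine MaxFilter.eq_of_le fun b hb => ?_
  have h1 := h _ (μ.meet_mem hb hμ) a hν
  refine ν.up h1 ?_
  rw [hl]; intro x y; simp only [hr, hm]; rintro ⟨⟨z, h1, h2⟩, h3⟩
  rwa [fn a x y z h3 h2]

theorem isLocalHomeomorph_mk : IsLocalHomeomorph (Quotient.mk (maxFilterSetoid A)) := by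
  rw [isLocalHomeomorph_iff_isOpenEmbedding_restrict]
  intro μ
  obtain ⟨a, ha⟩ := μ.isFilter.nonempty
  refine ⟨hat a, (isOpen_hat a).mem_nhds ha, ?_⟩
  refine Topology.IsOpenEmbedding.of_continuous_injective_isOpenMap
    (continuous_quotient_mk'.comp continuous_subtype_val) ?_ ?_
  · exact Set.injOn_iff_injective.1 (injOn_mk_hat a)
  · exact isOpenMap_mk.comp (isOpen_hat a).isOpenMap_subtype_val

instance : T2Space (Quotient (maxFilterSetoid A)) := by
  refine ⟨fun p q => ?_⟩
  induction p using Quotient.inductionOn with | _ μ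
  induction q using Quotient.inductionOn with | _ ν
  intro hne
  obtain ⟨a, ha, b, hb, hab⟩ : ∃ a ∈ μ, ∃ b ∈ ν, rest a b ∉ ν := by
    by_contra! h
    exact hne (Quotient.sound h)
  refine ⟨_, _, isOpenMap_mk _ (isOpen_hat a), isOpenMap_mk _ (isOpen_hat (diff b (rest a b))),
    ⟨μ, ha, rfl⟩, ⟨ν, rest_split ν hb a hab, rfl⟩, ?_⟩
  rw [Set.disjoint_left]
  rintro _ ⟨ξ, hξ, rfl⟩ ⟨ζ, hζ, h⟩
  have h : ξ ≈ ζ := Setoid.symm (Quotient.exact h)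
  obtain ⟨X, Y, r, inj, fn, hd, hr, hm, hl⟩ := A.exists_rel
  refine ζ.diff_self_notMem a (ζ.up (h a hξ _ hζ) ?_)
  rw [hl]; intro x y; simp only [hr, hd]; tauto

end DRA

/-- A Hausdorff étale space: a surjective local homeomorphism `π : X → X₀` between Hausdorff spaces. -/
structure HausEtale : Type (u + 1) where
  /-- the total space `X` -/
  total : Type u
  /-- the base space `X₀` -/
  base : Type u
  [topTotal : TopologicalSpace total]
  [topBase : TopologicalSpace base]
  [t2Total : T2Space total]
  [t2Base : T2Space base]
  /-- the projection `π` -/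
  proj : total → base
  isLocalHomeomorph : IsLocalHomeomorph proj
  surjective : Function.Surjective proj

namespace HausEtale

instance (E : HausEtale.{u}) : TopologicalSpace E.total := E.topTotal
instance (E : HausEtale.{u}) : TopologicalSpace E.base := E.topBase
instance (E : HausEtale.{u}) : T2Space E.total := E.t2Total
instance (E : HausEtale.{u}) : T2Space E.base := E.t2Base

/-- Morphisms of Hausdorff étale spaces: continuous and proper partial functions that preserve
equivalence, and are fibrewise injective and fibrewise surjective. -/
@[ext]
structure Hom (D E : HausEtale.{u}) where
  toPFun : D.total →. E.total
  continuous : ∀ V : Set E.total, IsOpen V → IsOpen (toPFun.preimage V)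
  proper : ∀ V : Set E.total, IsCompact V → IsCompact (toPFun.preimage V)
  preserves_equiv : ∀ x x' y y', y ∈ toPFun x → y' ∈ toPFun x' →
    D.proj x = D.proj x' → E.proj y = E.proj y'
  fibrewise_injective : ∀ x x' y, y ∈ toPFun x → y ∈ toPFun x' → D.proj x = D.proj x' → x = x'
  fibrewise_surjective : ∀ x y y', y ∈ toPFun x → E.proj y' = E.proj y →
    ∃ x', D.proj x' = D.proj x ∧ y' ∈ toPFun x'

/-- The identity morphism. -/
def Hom.id (E : HausEtale.{u}) : Hom E E where
  toPFun := PFun.id E.total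
  continuous V hV := by rwa [← PFun.coe_id, PFun.coe_preimage, Set.preimage_id]
  proper V hV := by rwa [← PFun.coe_id, PFun.coe_preimage, Set.preimage_id]
  preserves_equiv x x' y y' h h' := by
    obtain rfl := Part.mem_some_iff.1 h
    obtain rfl := Part.mem_some_iff.1 h'
    exact fun h => h
  fibrewise_injective x x' y h h' _ := by
    obtain rfl := Part.mem_some_iff.1 h
    exact Part.mem_some_iff.1 h'
  fibrewise_surjective x y y' h h' := by
    obtain rfl := Part.mem_some_iff.1 h
    exact ⟨y', h', Part.mem_some_iff.2 rfl⟩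

theorem mem_comp {X Y Z : Type u} (g : Y →. Z) (f : X →. Y) (x : X) (z : Z) :
    z ∈ g.comp f x ↔ ∃ y, y ∈ f x ∧ z ∈ g y := by
  rw [PFun.comp_apply]
  exact Part.mem_bind_iff

/-- Composition of morphisms is the composition of partial functions. -/
def Hom.comp {C D E : HausEtale.{u}} (f : Hom C D) (g : Hom D E) : Hom C E where
  toPFun := g.toPFun.comp f.toPFun
  continuous V hV := by
    rw [PFun.preimage_comp]
    exact f.continuous _ (g.continuous _ hV)
  proper V hV := by
    rw [PFun.preimage_comp]
    exact f.proper _ (g.proper _ hV)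
  preserves_equiv x x' z z' h h' hx := by
    rw [mem_comp] at h h'
    obtain ⟨y, hy, hz⟩ := h
    obtain ⟨y', hy', hz'⟩ := h'
    exact g.preserves_equiv _ _ _ _ hz hz' (f.preserves_equiv _ _ _ _ hy hy' hx)
  fibrewise_injective x x' z h h' hx := by
    rw [mem_comp] at h h'
    obtain ⟨y, hy, hz⟩ := h
    obtain ⟨y', hy', hz'⟩ := h'
    obtain rfl := g.fibrewise_injective _ _ _ hz hz' (f.preserves_equiv _ _ _ _ hy hy' hx)
    exact f.fibrewise_injective _ _ _ hy hy' hx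
  fibrewise_surjective x z z' h hz' := by
    rw [mem_comp] at h
    obtain ⟨y, hy, hz⟩ := h
    obtain ⟨y', hy', hz''⟩ := g.fibrewise_surjective _ _ _ hz hz'
    obtain ⟨x', hx', h'⟩ := f.fibrewise_surjective _ _ _ hy hy'
    exact ⟨x', hx', (mem_comp _ _ _ _).2 ⟨y', h', hz''⟩⟩

/-- The category of Hausdorff étale spaces. -/
instance : Category HausEtale.{u} where
  Hom D E := Hom D E
  id E := Hom.id E
  comp f g := Hom.comp f g
  id_comp f := Hom.ext (PFun.comp_id f.toPFun)
  comp_id f := Hom.ext (PFun.id_comp f.toPFun)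
  assoc f g h := Hom.ext (PFun.comp_assoc h.toPFun g.toPFun f.toPFun).symm

end HausEtale

namespace DRA

variable {A B : DRA.{u}}

/-- The Hausdorff étale space of the maximal filters of `A`: the quotient map onto the set of
equivalence classes, which has the quotient topology. -/
def spec (A : DRA.{u}) : HausEtale.{u} where
  total := MaxFilter A
  base := Quotient (maxFilterSetoid A)
  proj := Quotient.mk (maxFilterSetoid A)
  isLocalHomeomorph := isLocalHomeomorph_mk
  surjective := Quotient.mk_surjective

theorem maximal_preimage (h : Hom A B) (ξ : MaxFilter B) (hξ : ∃ a, h.toFun a ∈ ξ) :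
    Maximal (fun F : Set A => IsFilter F ∧ F ≠ Set.univ) {a | h.toFun a ∈ ξ} := by
  refine maximal_of_split ⟨hξ, fun a b ha hab => ξ.up ha (h.mono hab), fun a b ha hb => ?_⟩ ?_ ?_
  · have := ξ.meet_mem ha hb
    rwa [← h.map_meet] at this
  · intro a ha b
    have := ξ.meet_or_diff ha (h.toFun b)
    rwa [← h.map_meet, ← h.map_diff] at this
  · intro a ha
    have ha : h.toFun (diff a a) ∈ ξ := ha
    rw [h.map_diff] at ha
    exact ξ.diff_self_notMem _ ha

/-- The partial function `ξ ↦ h⁻¹(ξ)`, defined for those `ξ` that contain some `h a`. -/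
def specPFun (h : Hom A B) : MaxFilter B →. MaxFilter A := fun ξ =>
  ⟨∃ a, h.toFun a ∈ ξ, fun hξ => ⟨{a | h.toFun a ∈ ξ}, maximal_preimage h ξ hξ⟩⟩

theorem mem_specPFun {h : Hom A B} {ξ : MaxFilter B} {μ : MaxFilter A} :
    μ ∈ specPFun h ξ ↔ ∀ a, a ∈ μ ↔ h.toFun a ∈ ξ := by
  constructor
  · rintro ⟨hξ, rfl⟩ a
    exact Iff.rfl
  · intro hμ
    obtain ⟨a, ha⟩ := μ.isFilter.nonempty
    exact ⟨⟨a, (hμ a).1 ha⟩, SetLike.coe_injective (Set.ext fun b => (hμ b).symm)⟩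

theorem preimage_hat (h : Hom A B) (a : A) : (specPFun h).preimage (hat a) = hat (h.toFun a) := by
  ext ξ
  rw [PFun.mem_preimage]
  constructor
  · rintro ⟨μ, hμ, hξ⟩
    exact (mem_specPFun.1 hξ a).1 hμ
  · intro hξ
    exact ⟨⟨_, maximal_preimage h ξ ⟨a, hξ⟩⟩, hξ, mem_specPFun.2 fun _ => Iff.rfl⟩

theorem isOpen_preimage (h : Hom A B) {V : Set (MaxFilter A)} (hV : IsOpen V) :
    IsOpen ((specPFun h).preimage V) := by
  rw [isOpen_iff_forall_mem_open]
  rintro ξ ⟨μ, hμ, hξ⟩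
  obtain ⟨_, ⟨a, rfl⟩, ha, haV⟩ := isBasis_hat.exists_subset_of_mem_open hμ hV
  refine ⟨hat (h.toFun a), ?_, isOpen_hat _, (mem_specPFun.1 hξ a).1 ha⟩
  rw [← preimage_hat]
  exact PFun.preimage_mono _ haV

theorem isCompact_preimage (h : Hom A B) {K : Set (MaxFilter A)} (hK : IsCompact K) :
    IsCompact ((specPFun h).preimage K) := by
  obtain ⟨t, ht⟩ := hK.elim_finite_subcover (fun a : A => hat a) isOpen_hat (fun μ _ => by
    obtain ⟨a, ha⟩ := μ.isFilter.nonempty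
    exact Set.mem_iUnion.2 ⟨a, ha⟩)
  have hC : IsCompact (⋃ a ∈ t, hat (h.toFun a)) := t.isCompact_biUnion fun a _ => isCompact_hat _
  have := hC.diff (isOpen_preimage h hK.isClosed.isOpen_compl)
  convert this using 1
  ext ξ
  constructor
  · rintro ⟨μ, hμ, hξ⟩
    refine ⟨?_, ?_⟩
    · obtain ⟨a, ha, hμa⟩ := Set.mem_iUnion₂.1 (ht hμ)
      exact Set.mem_iUnion₂.2 ⟨a, ha, (mem_specPFun.1 hξ a).1 hμa⟩
    · rintro ⟨μ', hμ', hξ'⟩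
      obtain rfl : μ = μ' := Part.mem_unique hξ hξ'
      exact hμ' hμ
  · rintro ⟨h1, h2⟩
    obtain ⟨a, -, ha⟩ := Set.mem_iUnion₂.1 h1
    have hd : ξ ∈ (specPFun h).preimage (hat a) := by rw [preimage_hat]; exact ha
    obtain ⟨μ, -, hξ⟩ := hd
    refine ⟨μ, ?_, hξ⟩
    by_contra hμ
    exact h2 ⟨μ, hμ, hξ⟩

/-- The morphism of étale spaces dual to a homomorphism. -/
def specMap (h : Hom A B) : HausEtale.Hom (spec B) (spec A) where
  toPFun := specPFun h
  continuous _ hV := isOpen_preimage h hV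
  proper _ hV := isCompact_preimage h hV
  preserves_equiv := fun (ξ ξ' : MaxFilter B) (μ μ' : MaxFilter A) hμ hμ' hξ => by
    have hμ : μ ∈ specPFun h ξ := hμ
    have hμ' : μ' ∈ specPFun h ξ' := hμ'
    have hξ : ξ ≈ ξ' := Quotient.exact hξ
    refine Quotient.sound fun a ha b hb => ?_
    rw [mem_specPFun.1 hμ] at ha
    rw [mem_specPFun.1 hμ'] at hb ⊢
    rw [h.map_rest]
    exact hξ _ ha _ hb
  fibrewise_injective ξ ξ' μ hμ hμ' hξ := by
    obtain ⟨a, ha⟩ := μ.isFilter.nonempty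
    exact injOn_mk_hat (h.toFun a) ((mem_specPFun.1 hμ a).1 ha) ((mem_specPFun.1 hμ' a).1 ha) hξ
  fibrewise_surjective := fun (ξ : MaxFilter B) (μ μ' : MaxFilter A) hμ hμ' => by
    have hμ : μ ∈ specPFun h ξ := hμ
    have hμ' : μ' ≈ μ := Quotient.exact hμ'
    rw [mem_specPFun] at hμ
    obtain ⟨a, ha⟩ := μ'.isFilter.nonempty
    obtain ⟨d, hdμ⟩ := μ.isFilter.nonempty
    obtain ⟨ν, h1, h2⟩ := exists_equiv ξ (M := h.toFun '' {a | a ∈ μ'}) ⟨_, a, ha, rfl⟩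
      (by
        rintro _ ⟨b, hb, rfl⟩ _ ⟨c, hc, rfl⟩
        exact ⟨_, μ'.meet_mem hb hc, h.map_meet b c⟩)
      (by
        rintro _ ⟨b, hb, rfl⟩ e he
        have h3 := (hμ _).1 (hμ' b hb d hdμ)
        rw [h.map_rest] at h3
        refine ξ.up (ξ.meet_mem h3 he) ?_
        obtain ⟨X, Y, r, inj, fn, hd, hr, hm, hl⟩ := B.exists_rel
        rw [hl]; intro x y; simp only [hm, hr]; tauto)
    refine ⟨ν, Quotient.sound h2, ?_⟩
    have hν : ∃ a, h.toFun a ∈ ν := ⟨a, h1 _ ⟨a, ha, rfl⟩⟩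
    have : μ' = ⟨_, maximal_preimage h ν hν⟩ := MaxFilter.eq_of_le fun b hb => h1 _ ⟨b, hb, rfl⟩
    rw [this]
    exact mem_specPFun.2 fun _ => Iff.rfl

end DRA

/-- The functor `F`, which maps a difference–restriction algebra to the étale space of its maximal
filters, and a homomorphism `h` to the partial function `ξ ↦ h⁻¹(ξ)`. -/
def functorF : DRA.{u} ⥤ HausEtale.{u}ᵒᵖ where
  obj A := Opposite.op (DRA.spec A)
  map h := Quiver.Hom.op (DRA.specMap h)
  map_id A := Quiver.Hom.unop_inj <| HausEtale.Hom.ext <| PFun.ext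
      fun (ξ μ : DRA.MaxFilter A) => by
    refine DRA.mem_specPFun.trans ?_
    refine Iff.trans ?_ (Part.mem_some_iff (a := ξ)).symm
    exact ⟨fun h => SetLike.ext h, fun h a => h ▸ Iff.rfl⟩
  map_comp {A B C} f g := Quiver.Hom.unop_inj <| HausEtale.Hom.ext <| PFun.ext
      fun (ξ : DRA.MaxFilter C) (μ : DRA.MaxFilter A) => by
    refine DRA.mem_specPFun.trans ?_
    refine Iff.trans ?_ (HausEtale.mem_comp (DRA.specPFun f) (DRA.specPFun g) ξ μ).symm
    constructor
    · intro h
      obtain ⟨a, ha⟩ := μ.isFilter.nonempty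
      refine ⟨⟨_, DRA.maximal_preimage g ξ ⟨f.toFun a, (h a).1 ha⟩⟩, ?_, ?_⟩
      · exact DRA.mem_specPFun.2 fun _ => Iff.rfl
      · exact DRA.mem_specPFun.2 h
    · rintro ⟨ν, h1, h2⟩ a
      exact (DRA.mem_specPFun.1 h2 a).trans (DRA.mem_specPFun.1 h1 _)

namespace HausEtale

/-- The compact open subsets `U` of the total space for which `π|_U` is injective. -/
@[ext]
structure KO (E : HausEtale.{u}) : Type u where
  carrier : Set E.total
  isCompact : IsCompact carrier
  isOpen : IsOpen carrier
  injOn : Set.InjOn E.proj carrier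

/-- `U - V` is the set difference, and `U ▷ V = π⁻¹(π(U)) ∩ V`. -/
instance (E : HausEtale.{u}) : DiffRest E.KO where
  diff U V := ⟨U.carrier \ V.carrier, U.isCompact.diff V.isOpen,
    U.isOpen.sdiff V.isCompact.isClosed, U.injOn.mono Set.sdiff_subset⟩
  rest U V := ⟨E.proj ⁻¹' (E.proj '' U.carrier) ∩ V.carrier,
    V.isCompact.inter_left ((U.isCompact.image E.isLocalHomeomorph.continuous).isClosed.preimage
      E.isLocalHomeomorph.continuous),
    ((E.isLocalHomeomorph.isOpenMap _ U.isOpen).preimage E.isLocalHomeomorph.continuous).inter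
      V.isOpen, V.injOn.mono Set.inter_subset_right⟩

/-- The partial section `{(π(x), x) | x ∈ U}`. -/
noncomputable def KO.partialSection {E : HausEtale.{u}} (U : E.KO) : E.base →. E.total := fun p =>
  ⟨∃ x ∈ U.carrier, E.proj x = p, fun h => h.choose⟩

theorem KO.mem_partialSection {E : HausEtale.{u}} (U : E.KO) (p : E.base) (x : E.total) :
    x ∈ U.partialSection p ↔ x ∈ U.carrier ∧ E.proj x = p := by
  constructor
  · rintro ⟨h, rfl⟩
    exact h.choose_spec
  · intro hx
    have h : ∃ x ∈ U.carrier, E.proj x = p := ⟨x, hx⟩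
    exact ⟨h, U.injOn h.choose_spec.1 hx.1 (h.choose_spec.2.trans hx.2.symm)⟩

/-- The difference–restriction algebra of the compact open subsets on which `π` is injective. -/
def algebra (E : HausEtale.{u}) : DRA.{u} where
  carrier := E.KO
  nonempty := ⟨⟨∅, isCompact_empty, isOpen_empty, Set.injOn_empty _⟩⟩
  representable := by
    refine ⟨E.base, E.total, KO.partialSection, fun U V h => KO.ext (Set.ext fun x => ?_), ?_, ?_⟩
    · have h1 := U.mem_partialSection (E.proj x) x
      rw [h, KO.mem_partialSection] at h1
      tauto
    · intro U V p x
      simp only [KO.mem_partialSection]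
      change (x ∈ U.carrier ∧ x ∉ V.carrier) ∧ _ ↔ _
      tauto
    · intro U V p x
      rw [PFun.mem_dom]
      simp only [KO.mem_partialSection]
      change ((∃ y ∈ U.carrier, E.proj y = E.proj x) ∧ x ∈ V.carrier) ∧ _ ↔ _
      constructor
      · rintro ⟨⟨⟨y, hy, hyx⟩, hx⟩, rfl⟩
        exact ⟨⟨y, hy, hyx⟩, hx, rfl⟩
      · rintro ⟨⟨y, hy, hyx⟩, hx, rfl⟩
        exact ⟨⟨⟨y, hy, hyx⟩, hx⟩, rfl⟩

/-- The homomorphism `U ↦ φ⁻¹(U)`. -/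
def algebraMap {D E : HausEtale.{u}} (φ : Hom D E) : DRA.Hom (algebra E) (algebra D) where
  toFun U := KO.mk (φ.toPFun.preimage (KO.carrier U)) (φ.proper _ (KO.isCompact U))
    (φ.continuous _ (KO.isOpen U)) (by
      rintro x ⟨y, hy, hxy⟩ x' ⟨y', hy', hxy'⟩ hx
      obtain rfl := KO.injOn U hy hy' (φ.preserves_equiv _ _ _ _ hxy hxy' hx)
      exact φ.fibrewise_injective _ _ _ hxy hxy' hx)
  map_diff U V := KO.ext (Set.ext fun x => by
    constructor
    · rintro ⟨y, ⟨hU, hV⟩, hy⟩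
      refine ⟨⟨y, hU, hy⟩, ?_⟩
      rintro ⟨y', hV', hy'⟩
      obtain rfl := Part.mem_unique hy hy'
      exact hV hV'
    · rintro ⟨⟨y, hU, hy⟩, hV⟩
      exact ⟨y, ⟨hU, fun h => hV ⟨y, h, hy⟩⟩, hy⟩)
  map_rest U V := KO.ext (Set.ext fun x => by
    constructor
    · rintro ⟨y, ⟨⟨z, hz, hzy⟩, hV⟩, hy⟩
      obtain ⟨x', hx', hzx'⟩ := φ.fibrewise_surjective x y z hy hzy
      exact ⟨⟨x', ⟨z, hz, hzx'⟩, hx'⟩, y, hV, hy⟩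
    · rintro ⟨⟨x', ⟨z, hz, hzx'⟩, hx'⟩, y, hV, hy⟩
      exact ⟨y, ⟨⟨z, hz, φ.preserves_equiv _ _ _ _ hzx' hy hx'⟩, hV⟩, hy⟩)

end HausEtale

/-- The functor `G`, which maps an étale space to the algebra of the compact open subsets of the
total space on which the projection is injective, and a morphism `φ` to `U ↦ φ⁻¹(U)`. -/
def functorG : HausEtale.{u}ᵒᵖ ⥤ DRA.{u} where
  obj E := E.unop.algebra
  map φ := HausEtale.algebraMap φ.unop
  map_id E := DRA.Hom.ext <| funext fun U => HausEtale.KO.ext <| by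
    change (PFun.id _).preimage _ = _
    rw [← PFun.coe_id, PFun.coe_preimage]
    rfl
  map_comp φ ψ := DRA.Hom.ext <| funext fun U => HausEtale.KO.ext <|
    PFun.preimage_comp φ.unop.toPFun ψ.unop.toPFun _

/-- Two elements of a difference–restriction algebra are compatible if `a ▷ b = b ▷ a`. -/
def DRA.Compatible {A : DRA.{u}} (a b : A) : Prop := rest a b = rest b a

/-- The finitarily compatibly complete algebras: every finite set of pairwise compatible elements
has a join. -/
def finCompatiblyComplete : ObjectProperty DRA.{u} := fun A =>
  ∀ S : Set A, S.Finite → (∀ a ∈ S, ∀ b ∈ S, DRA.Compatible a b) → ∃ j : A, IsLUB S j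

/-- The Hausdorff étale spaces whose total space is locally compact (every point has a neighbourhood
basis of compact sets) and zero-dimensional (every point has a neighbourhood basis of clopen
sets). -/
def stonePlusEtale : ObjectProperty HausEtale.{u} := fun E =>
  LocallyCompactSpace E.total ∧
    ∀ x : E.total, ∀ N ∈ nhds x, ∃ V ∈ nhds x, IsClopen V ∧ V ⊆ N

/-- The restriction of `F` to the two full subcategories. -/
def restrictF
    (hF : ∀ A : DRA.{u}, finCompatiblyComplete A → stonePlusEtale (functorF.obj A).unop) :
    finCompatiblyComplete.{u}.FullSubcategory ⥤ stonePlusEtale.{u}.FullSubcategoryᵒᵖ where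
  obj A := Opposite.op ⟨(functorF.obj A.obj).unop, hF A.obj A.property⟩
  map h := (ObjectProperty.homMk (functorF.map h.hom).unop).op

/-- The restriction of `G` to the two full subcategories. -/
def restrictG
    (hG : ∀ E : HausEtale.{u}, stonePlusEtale E → finCompatiblyComplete (functorG.obj (.op E))) :
    stonePlusEtale.{u}.FullSubcategoryᵒᵖ ⥤ finCompatiblyComplete.{u}.FullSubcategory where
  obj E := ⟨functorG.obj (.op E.unop.obj), hG E.unop.obj E.unop.property⟩
  map φ := ObjectProperty.homMk (functorG.map φ.unop.hom.op)

/-! In a representation of `A`, the elements whose graph contains a fixed pair (x, y) form a maximal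
filter, so there are enough maximal filters to separate elements. A maximal filter behaves like an
ultrafilter relative to each of its members: if it contains `a`, it contains exactly one of `meet a
b` and `diff a b`. Hence `hat` turns difference into set difference. It turns `rest` into
restriction to saturated sets because a filter containing `rest a b` is equivalent to one containing
`a` (`exists_equiv`). So `hatHom` embeds `A` into the algebra of its spectrum.

Conversely, a point x of an étale space gives the filter of all members of G(π) around it. Both
natural maps are given by membership (`a` in μ, x in U), and so the triangle identities reduce to
the fact that reading off membership twice changes nothing.

For the duality, two maps must be invertible. The unit is onto when `A` is finitarily compatibly
complete: a compact open set on which the projection is injective is a finite union of sets `hat a`,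
these `a` are pairwise compatible, and `hat` sends finite joins to unions
(`hat_eq_iUnion_of_isLUB`). The counit is a homeomorphism when the sets in G(π) form a basis
(`exists_KO_subset`): they separate points, and by compactness every maximal filter comes from a
point (`exists_forall_mem_KO`). -/

namespace DRA

variable {A B : DRA.{u}}

/-! ### The unit: an algebra inside the algebra of its spectrum -/

theorem hat_diff (a b : A) : hat (diff a b) = hat a \ hat b := by
  obtain ⟨X, Y, r, inj, fn, hd, hr, hm, hl⟩ := A.exists_rel
  ext μ
  constructor
  · intro h
    have ha : a ∈ μ := μ.up h (by rw [hl]; intro x y; rw [hd]; tauto)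
    refine ⟨ha, fun hb => μ.not_both a b ⟨μ.meet_mem ha hb, h⟩⟩
  · rintro ⟨ha, hb⟩
    refine (μ.meet_or_diff ha b).resolve_left fun h => hb (μ.up h ?_)
    rw [hl]; intro x y; rw [hm]; tauto

theorem hat_rest (a b : A) : hat (rest a b) =
    Quotient.mk (maxFilterSetoid A) ⁻¹' (Quotient.mk (maxFilterSetoid A) '' hat a) ∩ hat b := by
  obtain ⟨X, Y, r, inj, fn, hd, hr, hm, hl⟩ := A.exists_rel
  ext μ
  constructor
  · intro h
    refine ⟨?_, μ.up h (by rw [hl]; intro x y; rw [hr]; tauto)⟩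
    -- The nontrivial inclusion: `a` must be realised by some filter in the class of `μ`. The
    -- hypothesis `rest a b ∈ μ` says that members of `μ` can be restricted to the domain of `a`.
    obtain ⟨ν, h1, h2⟩ := exists_equiv μ (M := {a}) ⟨a, rfl⟩
      (by
        rintro _ rfl _ rfl
        exact inj _ _ fun x y => by rw [hm, and_self])
      (by
        rintro _ rfl e he
        refine μ.up (μ.meet_mem h he) ?_
        rw [hl]; intro x y; simp only [hm, hr]; tauto)
    exact ⟨ν, h1 a rfl, Quotient.sound h2⟩
  · rintro ⟨⟨ν, ha, h⟩, hb⟩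
    exact (Quotient.exact h : ν ≈ μ) a ha b hb

/-- Maximal filters separate the elements: `a ↦ â` is an order embedding. -/
theorem hat_subset_hat_iff {a b : A} : hat a ⊆ hat b ↔ a ≤ b := by
  refine ⟨fun h => ?_, fun h μ hμ => μ.up hμ h⟩
  obtain ⟨X, Y, r, inj, fn, hd, hr, hm, hl⟩ := A.exists_rel
  rw [hl]
  intro x y hxy
  -- A pair (x, y) in the graph of `a` but not of `b` would give a maximal filter that contains `a`
  -- and omits `b`. No choice principle is needed to extend a filter.
  have hF : IsFilter {c | r c x y} := by
    refine ⟨⟨a, hxy⟩, fun b c hb hbc => (hl _ _).1 hbc x y hb, fun b c hb hc => ?_⟩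
    exact (hm _ _ _ _).2 ⟨hb, hc⟩
  have hmax := maximal_of_split hF
    (fun b hb c => by
      simp only [Set.mem_ofPred_eq, hm, hd] at *
      tauto)
    (fun b hb => by
      have hb : r (diff b b) x y := hb
      rw [hd] at hb
      exact hb.2 hb.1)
  exact @h ⟨_, hmax⟩ hxy

theorem hat_injective : Function.Injective (hat (A := A)) := by
  intro a b h
  obtain ⟨X, Y, r, inj, fn, hd, hr, hm, hl⟩ := A.exists_rel
  have h1 := (hl _ _).1 (hat_subset_hat_iff.1 h.le)
  have h2 := (hl _ _).1 (hat_subset_hat_iff.1 h.ge)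
  exact inj _ _ fun x y => ⟨h1 x y, h2 x y⟩

/-- The homomorphism `a ↦ â`. -/
def hatHom (A : DRA.{u}) : Hom A (HausEtale.algebra (spec A)) where
  toFun a := HausEtale.KO.mk (E := spec A) (hat a) (isCompact_hat a) (isOpen_hat a) (injOn_mk_hat a)
  map_diff a b := HausEtale.KO.ext (hat_diff a b)
  map_rest a b := HausEtale.KO.ext (hat_rest a b)

theorem hatHom_naturality (h : Hom A B) (a : A) :
    (HausEtale.algebraMap (specMap h)).toFun ((hatHom A).toFun a) = (hatHom B).toFun (h.toFun a) :=
  HausEtale.KO.ext (preimage_hat h a)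

theorem stonePlusEtale_spec (A : DRA.{u}) : stonePlusEtale (spec A) := by
  have key : ∀ (μ : MaxFilter A), ∀ N ∈ nhds μ, ∃ a, μ ∈ hat a ∧ hat a ⊆ N := by
    intro μ N hN
    obtain ⟨_, ⟨a, rfl⟩, h1, h2⟩ := isBasis_hat.mem_nhds_iff.1 hN
    exact ⟨a, h1, h2⟩
  refine ⟨⟨fun (μ : MaxFilter A) N hN => ?_⟩, fun (μ : MaxFilter A) N hN => ?_⟩
  · obtain ⟨a, h1, h2⟩ := key μ N hN
    exact ⟨hat a, (isOpen_hat a).mem_nhds h1, h2, isCompact_hat a⟩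
  · obtain ⟨a, h1, h2⟩ := key μ N hN
    exact ⟨hat a, (isOpen_hat a).mem_nhds h1, ⟨(isCompact_hat a).isClosed, isOpen_hat a⟩, h2⟩

/-- A finite union of the compact sets `hat a` is closed, so a filter in `hat j` outside it has a
basic neighbourhood `hat c` that misses it. Then `diff j c` is still an upper bound of `S`, so `j ≤
diff j c`, which is impossible at that filter. -/
theorem hat_eq_iUnion_of_isLUB {S : Set A} (hS : S.Finite) {j : A} (hj : IsLUB S j) :
    hat j = ⋃ a ∈ S, hat a := by
  refine Set.Subset.antisymm (fun μ hμ => ?_)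
    (Set.iUnion₂_subset fun a ha => hat_subset_hat_iff.2 (hj.1 ha))
  by_contra hcon
  have hclosed : IsClosed (⋃ a ∈ S, hat a) :=
    hS.isClosed_biUnion fun a _ => (isCompact_hat a).isClosed
  obtain ⟨_, ⟨c, rfl⟩, hc, hcS⟩ :=
    isBasis_hat.exists_subset_of_mem_open hcon hclosed.isOpen_compl
  have hub : diff j c ∈ upperBounds S := by
    intro a ha
    rw [← hat_subset_hat_iff, hat_diff]
    intro ν hν
    exact ⟨hat_subset_hat_iff.2 (hj.1 ha) hν, fun h => hcS h (Set.mem_biUnion ha hν)⟩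
  have := hat_subset_hat_iff.2 (hj.2 hub) hμ
  rw [hat_diff] at this
  exact this.2 hc

theorem hatHom_bijective (hA : finCompatiblyComplete A) :
    Function.Bijective (hatHom A).toFun := by
  refine ⟨fun a b h => hat_injective (congrArg HausEtale.KO.carrier h), ?_⟩
  intro (U : HausEtale.KO (spec A))
  have hUc : IsCompact (X := MaxFilter A) U.carrier := U.isCompact
  have hUo : IsOpen (X := MaxFilter A) U.carrier := U.isOpen
  obtain ⟨t, htU, ht, hUt⟩ := hUc.elim_finite_subcover_image (b := {a | hat a ⊆ U.carrier})
    (c := fun a : A => hat a) (fun a _ => isOpen_hat a) (fun μ hμ => by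
      obtain ⟨_, ⟨a, rfl⟩, h1, h2⟩ := isBasis_hat.exists_subset_of_mem_open hμ hUo
      exact Set.mem_biUnion (show a ∈ {a | hat a ⊆ U.carrier} from h2) h1)
  -- Both sets lie in `U`, where the projection is injective: equivalent filters in `hat a` and `hat
  -- b` coincide. The resulting formula is symmetric in `a` and `b`, which is compatibility.
  have hrest : ∀ a ∈ t, ∀ b ∈ t, hat (rest a b) = hat a ∩ hat b := by
    intro a ha b hb
    rw [hat_rest]
    ext ν
    constructor
    · rintro ⟨⟨μ, hμ, h⟩, hν⟩
      obtain rfl : μ = ν := U.injOn (htU ha hμ) (htU hb hν) h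
      exact ⟨hμ, hν⟩
    · rintro ⟨h1, h2⟩
      exact ⟨⟨ν, h1, rfl⟩, h2⟩
  obtain ⟨j, hj⟩ := hA t ht fun a ha b hb => hat_injective <| by
    rw [hrest a ha b hb, hrest b hb a ha, Set.inter_comm]
  refine ⟨j, HausEtale.KO.ext ?_⟩
  change hat j = U.carrier
  rw [hat_eq_iUnion_of_isLUB ht hj]
  exact Set.Subset.antisymm (Set.iUnion₂_subset fun a ha => htU ha) hUt

theorem isIso_of_bijective (h : A ⟶ B) (hh : Function.Bijective (Hom.toFun h)) : IsIso h := by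
  let e := Equiv.ofBijective _ hh
  have he : ∀ a, e a = Hom.toFun h a := fun _ => rfl
  refine ⟨⟨e.symm, fun a b => ?_, fun a b => ?_⟩, Hom.ext (funext e.symm_apply_apply),
    Hom.ext (funext e.apply_symm_apply)⟩
  · rw [Equiv.symm_apply_eq, he, Hom.map_diff, ← he, ← he, e.apply_symm_apply, e.apply_symm_apply]
  · rw [Equiv.symm_apply_eq, he, Hom.map_rest, ← he, ← he, e.apply_symm_apply, e.apply_symm_apply]

end DRA

/-! ### The counit: points as maximal filters of compact open sets -/

namespace HausEtale

variable {D E : HausEtale.{u}}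

open DRA

theorem KO.mem_diff {U V : E.KO} {x : E.total} :
    x ∈ KO.carrier (diff U V) ↔ x ∈ U.carrier ∧ x ∉ V.carrier := Iff.rfl

theorem KO.mem_meet {U V : E.KO} {x : E.total} :
    x ∈ KO.carrier (meet U V) ↔ x ∈ U.carrier ∧ x ∈ V.carrier := by
  rw [meet, mem_diff, mem_diff]
  tauto

theorem KO.le_iff {U V : algebra E} : U ≤ V ↔ KO.carrier U ⊆ KO.carrier V := by
  refine ⟨fun h x hx => ?_, fun h => KO.ext (Set.ext fun x => ?_)⟩
  · have h : meet U V = U := h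
    rw [← h] at hx
    exact (KO.mem_meet.1 hx).2
  · exact KO.mem_meet.trans ⟨fun hx => hx.1, fun hx => ⟨hx, h hx⟩⟩

theorem maximal_setOf_mem (x : E.total) (hx : ∃ U : E.KO, x ∈ U.carrier) :
    Maximal (fun F : Set (algebra E) => IsFilter F ∧ F ≠ Set.univ)
      {U : E.KO | x ∈ U.carrier} := by
  refine maximal_of_split
    ⟨hx, fun U V hU hUV => KO.le_iff.1 hUV hU, fun U V hU hV => KO.mem_meet.2 ⟨hU, hV⟩⟩ ?_ ?_
  · intro U hU V
    by_cases hV : x ∈ KO.carrier V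
    · exact Or.inl (KO.mem_meet.2 ⟨hU, hV⟩)
    · exact Or.inr ⟨hU, hV⟩
  · exact fun U hU => hU.2 hU.1

/-- The partial function `x ↦ {U | x ∈ U}`, defined where this set is nonempty. -/
def pointPFun (E : HausEtale.{u}) : E.total →. MaxFilter (algebra E) := fun x =>
  ⟨∃ U : E.KO, x ∈ U.carrier, fun hx => ⟨_, maximal_setOf_mem x hx⟩⟩

theorem mem_pointPFun {x : E.total} {μ : MaxFilter (algebra E)} :
    μ ∈ pointPFun E x ↔ ∀ U : E.KO, U ∈ μ ↔ x ∈ U.carrier := by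
  constructor
  · rintro ⟨hx, rfl⟩ U
    exact Iff.rfl
  · intro hμ
    obtain ⟨U, hU⟩ := μ.isFilter.nonempty
    exact ⟨⟨U, (hμ U).1 hU⟩, SetLike.coe_injective (Set.ext fun V => (hμ V).symm)⟩

theorem exists_mem_pointPFun {x : E.total} {U : E.KO} (hx : x ∈ U.carrier) :
    ∃ μ, μ ∈ pointPFun E x := ⟨_, ⟨U, hx⟩, rfl⟩

/-- One inclusion is enough: `μ` is contained in the proper filter of `x`, so maximality makes them
equal. -/
theorem mem_pointPFun_of_forall {x : E.total} {μ : MaxFilter (algebra E)}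
    (h : ∀ U : E.KO, U ∈ μ → x ∈ U.carrier) : μ ∈ pointPFun E x := by
  obtain ⟨U, hU⟩ := μ.isFilter.nonempty
  obtain ⟨ν, hν⟩ := exists_mem_pointPFun (h U hU)
  obtain rfl : μ = ν := MaxFilter.eq_of_le fun V hV => (mem_pointPFun.1 hν V).2 (h V hV)
  exact hν

theorem preimage_pointPFun_hat (U : E.KO) :
    (pointPFun E).preimage (hat (A := algebra E) U) = U.carrier := by
  ext x
  rw [PFun.mem_preimage]
  constructor
  · rintro ⟨μ, hμ, hx⟩
    exact (mem_pointPFun.1 hx U).1 hμ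
  · intro hU
    obtain ⟨μ, hx⟩ := exists_mem_pointPFun hU
    exact ⟨μ, (mem_pointPFun.1 hx U).2 hU, hx⟩

theorem isOpen_preimage_pointPFun {V : Set (MaxFilter (algebra E))} (hV : IsOpen V) :
    IsOpen ((pointPFun E).preimage V) := by
  rw [isOpen_iff_forall_mem_open]
  rintro x ⟨μ, hμ, hx⟩
  obtain ⟨_, ⟨U, rfl⟩, hU, hUV⟩ := isBasis_hat.exists_subset_of_mem_open hμ hV
  refine ⟨KO.carrier U, ?_, KO.isOpen U, (mem_pointPFun.1 hx U).1 hU⟩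
  exact (preimage_pointPFun_hat U).symm.subset.trans (PFun.preimage_mono _ hUV)

/-- Finitely many `hat U` cover `K`, and their preimages are the compact sets `U`. Since `K` is
closed, its preimage is the union of these `U` minus the open preimage of the complement of `K`. -/
theorem isCompact_preimage_pointPFun {K : Set (MaxFilter (algebra E))} (hK : IsCompact K) :
    IsCompact ((pointPFun E).preimage K) := by
  obtain ⟨t, ht⟩ := hK.elim_finite_subcover (fun U : algebra E => hat U) isOpen_hat (fun μ _ => by
    obtain ⟨U, hU⟩ := μ.isFilter.nonempty
    exact Set.mem_iUnion.2 ⟨U, hU⟩)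
  have hC : IsCompact (⋃ U ∈ t, KO.carrier U) := t.isCompact_biUnion fun U _ => KO.isCompact U
  convert hC.diff (isOpen_preimage_pointPFun hK.isClosed.isOpen_compl) using 1
  ext x
  constructor
  · rintro ⟨μ, hμ, hx⟩
    refine ⟨?_, ?_⟩
    · obtain ⟨U, hU, hμU⟩ := Set.mem_iUnion₂.1 (ht hμ)
      exact Set.mem_iUnion₂.2 ⟨U, hU, (mem_pointPFun.1 hx U).1 hμU⟩
    · rintro ⟨μ', hμ', hx'⟩
      obtain rfl : μ = μ' := Part.mem_unique hx hx'
      exact hμ' hμ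
  · rintro ⟨h1, h2⟩
    obtain ⟨U, -, hU⟩ := Set.mem_iUnion₂.1 h1
    obtain ⟨μ, hx⟩ := exists_mem_pointPFun hU
    refine ⟨μ, ?_, hx⟩
    by_contra hμ
    exact h2 ⟨μ, hμ, hx⟩

/-- The morphism `x ↦ {U | x ∈ U}`. -/
def pointHom (E : HausEtale.{u}) : Hom E (spec (algebra E)) where
  toPFun := pointPFun E
  continuous _ hV := isOpen_preimage_pointPFun hV
  proper _ hV := isCompact_preimage_pointPFun hV
  preserves_equiv := fun x x' (μ μ' : MaxFilter (algebra E)) hμ hμ' hx => by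
    have hμ : μ ∈ pointPFun E x := hμ
    have hμ' : μ' ∈ pointPFun E x' := hμ'
    refine Quotient.sound fun U hU V hV => ?_
    exact (mem_pointPFun.1 hμ' _).2
      ⟨⟨x, (mem_pointPFun.1 hμ U).1 hU, hx⟩, (mem_pointPFun.1 hμ' V).1 hV⟩
  fibrewise_injective := fun x x' (μ : MaxFilter (algebra E)) hμ hμ' hx => by
    obtain ⟨U, hU⟩ := μ.isFilter.nonempty
    exact KO.injOn U ((mem_pointPFun.1 hμ U).1 hU) ((mem_pointPFun.1 hμ' U).1 hU) hx
  fibrewise_surjective := fun x (μ μ' : MaxFilter (algebra E)) hμ hμ' => by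
    have hμ : μ ∈ pointPFun E x := hμ
    have hμ' : μ' ≈ μ := Quotient.exact hμ'
    obtain ⟨W, hW⟩ := μ.isFilter.nonempty
    -- Equivalence puts `rest U W` in `μ`, the filter of `x`. So x lies in the saturation of `U`,
    -- which means that `U` meets the fibre through x.
    have key : ∀ U ∈ μ', ∃ y ∈ KO.carrier U, E.proj y = E.proj x := fun U hU =>
      ((mem_pointPFun.1 hμ _).1 (hμ' U hU W hW)).1
    obtain ⟨V, hV⟩ := μ'.isFilter.nonempty
    obtain ⟨x', hx', hxx'⟩ := key V hV
    refine ⟨x', hxx', mem_pointPFun_of_forall fun U hU => ?_⟩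
    -- The fixed `V` meets this fibre only in `x'`, so the fibre point found in the intersection of
    -- `U` and `V` must be `x'`.
    obtain ⟨y, hy, hyx⟩ := key _ (μ'.meet_mem hU hV)
    obtain ⟨hyU, hyV⟩ := KO.mem_meet.1 hy
    obtain rfl := KO.injOn V hyV hx' (hyx.trans hxx'.symm)
    exact hyU

/-- Both composites relate x to `μ` exactly when φ(x) is defined and the members of `μ` are the sets
in G containing φ(x). -/
theorem pointHom_naturality (φ : Hom D E) :
    Hom.comp (pointHom D) (specMap (algebraMap φ)) = Hom.comp φ (pointHom E) := by
  refine Hom.ext (PFun.ext fun (x : D.total) (μ : MaxFilter (algebra E)) => ?_)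
  refine (mem_comp (specPFun (algebraMap φ)) (pointPFun D) x μ).trans
    (Iff.trans ?_ (mem_comp (pointPFun E) φ.toPFun x μ).symm)
  constructor
  · rintro ⟨ν, hν, hμ⟩
    have key : ∀ U : E.KO, U ∈ μ ↔ ∃ y ∈ U.carrier, y ∈ φ.toPFun x := fun U =>
      (mem_specPFun.1 hμ U).trans (mem_pointPFun.1 hν _)
    obtain ⟨U, hU⟩ := μ.isFilter.nonempty
    obtain ⟨y, -, hy⟩ := (key U).1 hU
    refine ⟨y, hy, mem_pointPFun_of_forall fun V hV => ?_⟩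
    obtain ⟨z, hz, hz'⟩ := (key V).1 hV
    rwa [Part.mem_unique hy hz']
  · rintro ⟨y, hy, hμ⟩
    have key : ∀ U : E.KO, U ∈ μ ↔ x ∈ KO.carrier ((algebraMap φ).toFun U) := fun U =>
      (mem_pointPFun.1 hμ U).trans ⟨fun h => ⟨y, h, hy⟩, fun ⟨z, hz, hz'⟩ => by
        rwa [Part.mem_unique hy hz']⟩
    obtain ⟨U, hU⟩ := μ.isFilter.nonempty
    obtain ⟨ν, hν⟩ := exists_mem_pointPFun ((key U).1 hU)
    exact ⟨ν, hν, mem_specPFun.2 fun V => (key V).trans (mem_pointPFun.1 hν _).symm⟩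

/-- The join is the union. Compatibility makes the projection injective on it: if x in `U` and y in
`V` have the same image, then y lies in `rest U V = rest V U`, hence in `U`, where injectivity
applies. -/
theorem finCompatiblyComplete_algebra (E : HausEtale.{u}) : finCompatiblyComplete (algebra E) := by
  intro S hS hc
  refine ⟨KO.mk (⋃ U ∈ S, KO.carrier U) (hS.isCompact_biUnion fun U _ => KO.isCompact U)
    (isOpen_biUnion fun U _ => KO.isOpen U) ?_, ?_, ?_⟩
  · intro x hx y hy hxy
    obtain ⟨U, hU, hx⟩ := Set.mem_iUnion₂.1 hx
    obtain ⟨V, hV, hy⟩ := Set.mem_iUnion₂.1 hy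
    have h := congrArg KO.carrier (hc U hU V hV)
    have hyUV := h.subset (show y ∈ _ from ⟨⟨x, hx, hxy⟩, hy⟩)
    exact KO.injOn U hx hyUV.2 hxy
  · intro U hU
    exact KO.le_iff.2 (Set.subset_biUnion_of_mem (u := fun U => KO.carrier U) hU)
  · intro V hV
    exact KO.le_iff.2 (Set.iUnion₂_subset fun U hU => KO.le_iff.1 (hV hU))

/-! ### Invertibility of the counit in the locally compact zero-dimensional case -/

/-- A morphism whose partial function is a homeomorphism of the total spaces is an isomorphism. -/
theorem isIso_of_homeomorph (φ : D ⟶ E) (f : D.total ≃ₜ E.total)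
    (hf : ∀ x y, y ∈ Hom.toPFun φ x ↔ f x = y) : IsIso φ := by
  let g : E.total →. D.total := ((f.symm : E.total → D.total) : E.total →. D.total)
  have hg : ∀ y x, x ∈ g y ↔ f x = y := fun y x => by
    refine (Part.mem_some_iff (a := f.symm y)).trans ?_
    rw [f.eq_symm_apply]
  have hgp : ∀ V, g.preimage V = f.symm ⁻¹' V := fun V => PFun.coe_preimage _ _
  let ψ : Hom E D :=
    { toPFun := g
      continuous := fun V hV => by
        rw [hgp]
        exact hV.preimage f.symm.continuous
      proper := fun V hV => by
        rw [hgp]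
        exact f.symm.isCompact_preimage.2 hV
      preserves_equiv := by
        rintro _ _ x x' hx hx' h
        rw [hg] at hx hx'
        subst hx hx'
        -- Inversion exchanges two axioms: fibrewise surjectivity of `φ` yields preservation of
        -- equivalence for the inverse, and below preservation yields fibrewise surjectivity.
        obtain ⟨z, hz, hz'⟩ := Hom.fibrewise_surjective φ x _ (f x') ((hf _ _).2 rfl) h.symm
        rw [hf, f.injective.eq_iff] at hz'
        rw [← hz, hz']
      fibrewise_injective := by
        intro y y' x hx hx' _
        rw [hg] at hx hx'
        rw [← hx, hx']
      fibrewise_surjective := by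
        intro y x x' hx h
        rw [hg] at hx
        subst hx
        exact ⟨f x', Hom.preserves_equiv φ _ _ _ _ ((hf _ _).2 rfl) ((hf _ _).2 rfl) h,
          (hg _ _).2 rfl⟩ }
  refine ⟨ψ, Hom.ext (PFun.ext fun x x' => ?_), Hom.ext (PFun.ext fun y y' => ?_)⟩
  · refine (mem_comp g (Hom.toPFun φ) x x').trans
      (Iff.trans ?_ (Part.mem_some_iff (a := x)).symm)
    simp only [hf, hg]
    simp [eq_comm]
  · refine (mem_comp (Hom.toPFun φ) g y y').trans
      (Iff.trans ?_ (Part.mem_some_iff (a := y)).symm)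
    simp only [hf, hg]
    constructor
    · rintro ⟨x, rfl, rfl⟩
      rfl
    · rintro rfl
      exact ⟨f.symm y', by simp⟩

/-- In the locally compact zero-dimensional case, the sets in `G(π)` form a basis. -/
theorem exists_KO_subset (hE : stonePlusEtale E) {x : E.total} {N : Set E.total}
    (hN : N ∈ nhds x) : ∃ U : E.KO, x ∈ U.carrier ∧ U.carrier ⊆ N := by
  obtain ⟨h1, h2⟩ := hE
  obtain ⟨e, hxe, he⟩ := E.isLocalHomeomorph x
  have hinj : Set.InjOn E.proj e.source := he ▸ e.injOn
  -- Shrinking into a chart domain makes the projection injective on `K`; a clopen `V` inside the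
  -- compact `K` is then compact open.
  obtain ⟨K, hK, hKN, hKc⟩ := local_compact_nhds
    (Filter.inter_mem hN (e.open_source.mem_nhds hxe))
  obtain ⟨V, hV, hVc, hVK⟩ := h2 x K hK
  exact ⟨⟨V, hKc.of_isClosed_subset hVc.isClosed hVK, hVc.isOpen,
    hinj.mono fun y hy => (hKN (hVK hy)).2⟩, mem_of_mem_nhds hV, fun y hy => (hKN (hVK hy)).1⟩

/-- The members of `μ` are compact closed sets, directed downwards by `meet`, and nonempty because
the empty set is the least element and `μ` is proper. Compactness gives a common point. -/
theorem exists_forall_mem_KO (μ : MaxFilter (algebra E)) :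
    ∃ x : E.total, ∀ U : E.KO, U ∈ μ → x ∈ U.carrier := by
  obtain ⟨W, hW⟩ := μ.isFilter.nonempty
  have : Nonempty {U : E.KO // U ∈ μ} := ⟨⟨W, hW⟩⟩
  obtain ⟨x, hx⟩ := IsCompact.nonempty_iInter_of_directed_nonempty_isCompact_isClosed
    (fun U : {U : E.KO // U ∈ μ} => U.1.carrier)
    (by
      rintro ⟨U, hU⟩ ⟨V, hV⟩
      exact ⟨⟨_, μ.meet_mem hU hV⟩, fun x hx => (KO.mem_meet.1 hx).1,
        fun x hx => (KO.mem_meet.1 hx).2⟩)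
    (by
      rintro ⟨U, hU⟩
      by_contra hcon
      rw [Set.not_nonempty_iff_eq_empty] at hcon
      refine μ.diff_self_notMem U (μ.up hU (KO.le_iff.2 fun x hx => ?_))
      exact absurd hx (Set.eq_empty_iff_forall_notMem.1 hcon x))
    (fun U => U.1.isCompact) (fun U => U.1.isCompact.isClosed)
  exact ⟨x, fun U hU => Set.mem_iInter.1 hx ⟨U, hU⟩⟩

/-- With a basis of sets `U` from G(π), each point has a filter, and distinct points have distinct
filters. Since `hat U` pulls back to `U`, bases correspond and the bijection is a homeomorphism. -/
theorem isIso_pointHom (hE : stonePlusEtale E) :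
    IsIso (show E ⟶ spec (algebra E) from pointHom E) := by
  have htot : ∀ x : E.total, ∃ μ : MaxFilter (algebra E), μ ∈ pointPFun E x := fun x => by
    obtain ⟨U, hU, -⟩ := exists_KO_subset hE (Filter.univ_mem (f := nhds x))
    exact exists_mem_pointPFun hU
  choose f hf using htot
  have hf' : ∀ x μ, μ ∈ pointPFun E x ↔ f x = μ := fun x μ =>
    ⟨fun h => Part.mem_unique (hf x) h, fun h => h ▸ hf x⟩
  have hmem : ∀ x (U : E.KO), U ∈ f x ↔ x ∈ U.carrier := fun x => mem_pointPFun.1 (hf x)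
  have hbij : Function.Bijective f := by
    constructor
    · intro x y hxy
      by_contra hne
      obtain ⟨U, hxU, hU⟩ := exists_KO_subset hE (isOpen_compl_singleton.mem_nhds hne)
      exact hU ((hmem y U).1 (hxy ▸ (hmem x U).2 hxU)) rfl
    · intro μ
      obtain ⟨x, hx⟩ := exists_forall_mem_KO μ
      exact ⟨x, (hf' x μ).1 (mem_pointPFun_of_forall hx)⟩
  have hpre : ∀ U : E.KO, f ⁻¹' hat (A := algebra E) U = U.carrier := fun U =>
    Set.ext fun x => hmem x U
  have hcont : Continuous f := by
    rw [isBasis_hat.continuous_iff]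
    rintro _ ⟨U, rfl⟩
    exact (hpre U).symm ▸ KO.isOpen U
  have hopen : IsOpenMap f := by
    intro V hV
    rw [isOpen_iff_forall_mem_open]
    rintro _ ⟨x, hx, rfl⟩
    obtain ⟨U, hxU, hUV⟩ := exists_KO_subset hE (hV.mem_nhds hx)
    refine ⟨hat (A := algebra E) U, ?_, isOpen_hat _, (hmem x U).2 hxU⟩
    -- By surjectivity `hat U` is the image of its preimage `U`, and `U` lies in `V`.
    rw [← Set.image_preimage_eq (hat (A := algebra E) U) hbij.2, hpre]
    exact Set.image_mono hUV
  exact isIso_of_homeomorph _ ((Equiv.ofBijective f hbij).toHomeomorphOfContinuousOpen hcont hopen)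
    hf'

end HausEtale

/-! ### The adjunction and its restriction to a duality -/

/-- The adjunction with unit `a ↦ â` and counit `x ↦ {U | x ∈ U}`. -/
def adjunctionFG : functorF.{u} ⊣ functorG.{u} where
  unit :=
    { app := fun A => DRA.hatHom A
      naturality := fun _ _ h => DRA.Hom.ext <| funext fun a => (DRA.hatHom_naturality h a).symm }
  counit :=
    { app := fun E => Quiver.Hom.op (HausEtale.pointHom E.unop)
      naturality := fun _ _ φ => Quiver.Hom.unop_inj (HausEtale.pointHom_naturality φ.unop) }
  -- The filter of compact open sets around `ξ`, pulled back along `hat`, consists of the `a` with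
  -- `ξ ∈ hat a`, which is `ξ` again.
  left_triangle_components A := Quiver.Hom.unop_inj <| HausEtale.Hom.ext <| PFun.ext
      fun (ξ μ : DRA.MaxFilter A) => by
    refine (HausEtale.mem_comp (DRA.specPFun (DRA.hatHom A))
      (HausEtale.pointPFun (DRA.spec A)) ξ μ).trans
        (Iff.trans ?_ (Part.mem_some_iff (a := ξ)).symm)
    constructor
    · rintro ⟨ν, h1, h2⟩
      exact SetLike.ext fun a => (DRA.mem_specPFun.1 h2 a).trans (HausEtale.mem_pointPFun.1 h1 _)
    · rintro rfl
      obtain ⟨a, ha⟩ := μ.isFilter.nonempty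
      obtain ⟨ν, hν⟩ := HausEtale.exists_mem_pointPFun (E := DRA.spec A) (x := μ)
        (U := (DRA.hatHom A).toFun a) ha
      exact ⟨ν, hν, DRA.mem_specPFun.2 fun b =>
        (HausEtale.mem_pointPFun.1 hν ((DRA.hatHom A).toFun b)).symm⟩
  right_triangle_components E := DRA.Hom.ext <| funext fun U => HausEtale.KO.ext <|
    HausEtale.preimage_pointPFun_hat U

/-- The restriction of the adjunction to the two full subcategories. -/
def restrictedAdjunction
    (hF : ∀ A : DRA.{u}, finCompatiblyComplete A → stonePlusEtale (functorF.obj A).unop)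
    (hG : ∀ E : HausEtale.{u}, stonePlusEtale E → finCompatiblyComplete (functorG.obj (.op E))) :
    restrictF hF ⊣ restrictG hG where
  unit :=
    { app := fun A => ObjectProperty.homMk (adjunctionFG.unit.app A.obj)
      naturality := fun _ _ h => ObjectProperty.hom_ext _ (adjunctionFG.unit.naturality h.hom) }
  counit :=
    { app := fun E => (ObjectProperty.homMk (adjunctionFG.counit.app (.op E.unop.obj)).unop).op
      naturality := fun _ _ φ => by
        exact Quiver.Hom.unop_inj <| ObjectProperty.hom_ext _ <|
          HausEtale.pointHom_naturality φ.unop.hom }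
  left_triangle_components A := Quiver.Hom.unop_inj <| ObjectProperty.hom_ext _ <|
    congrArg Quiver.Hom.unop (adjunctionFG.left_triangle_components A.obj)
  right_triangle_components E := ObjectProperty.hom_ext _ <|
    adjunctionFG.right_triangle_components (.op E.unop.obj)

theorem proposition4 :
    ∃ adj : functorF.{u} ⊣ functorG.{u},
      -- the unit of the adjunction is `a ↦ â`
      (∀ (A : DRA.{u}) (a : A),
        HausEtale.KO.carrier ((adj.unit.app A).toFun a) = DRA.hat a) ∧
      -- the counit is the partial function `x ↦ {U | x ∈ U}`, defined where that set is nonempty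
      (∀ (E : HausEtale.{u}) (x : E.total) (μ : DRA.MaxFilter E.algebra),
        μ ∈ (adj.counit.app (.op E)).unop.toPFun x ↔
          ∀ U : E.KO, U ∈ μ ↔ x ∈ U.carrier) ∧
      -- the two functors and the adjunction restrict to the two full subcategories ...
      ∃ (hF : ∀ A : DRA.{u}, finCompatiblyComplete A → stonePlusEtale (functorF.obj A).unop)
        (hG : ∀ E : HausEtale.{u}, stonePlusEtale E →
          finCompatiblyComplete (functorG.obj (.op E)))
        (adj' : restrictF hF ⊣ restrictG hG),
        (∀ A : finCompatiblyComplete.{u}.FullSubcategory,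
          (adj'.unit.app A).hom = adj.unit.app A.obj) ∧
        (∀ E : stonePlusEtale.{u}.FullSubcategory,
          (adj'.counit.app (.op E)).unop.hom = (adj.counit.app (.op E.obj)).unop) ∧
        -- ... and there they form an equivalence of categories
        IsIso adj'.unit ∧ IsIso adj'.counit ∧
        (restrictF hF).IsEquivalence ∧ (restrictG hG).IsEquivalence := by
  have hF : ∀ A : DRA.{u}, finCompatiblyComplete A → stonePlusEtale (functorF.obj A).unop :=
    fun A _ => DRA.stonePlusEtale_spec A
  have hG : ∀ E : HausEtale.{u}, stonePlusEtale E →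
      finCompatiblyComplete (functorG.obj (.op E)) :=
    fun E _ => HausEtale.finCompatiblyComplete_algebra E
  -- Full subcategory inclusions reflect isomorphisms, so invertibility may be checked in the
  -- ambient categories.
  have hunit : ∀ A, IsIso ((restrictedAdjunction hF hG).unit.app A) := fun A => by
    have : IsIso (finCompatiblyComplete.ι.map ((restrictedAdjunction hF hG).unit.app A)) :=
      DRA.isIso_of_bijective _ (DRA.hatHom_bijective A.property)
    exact isIso_of_fully_faithful finCompatiblyComplete.ι _
  have hcounit : ∀ E, IsIso ((restrictedAdjunction hF hG).counit.app E) := fun E => by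
    have : IsIso (stonePlusEtale.ι.map ((restrictedAdjunction hF hG).counit.app E).unop) :=
      HausEtale.isIso_pointHom E.unop.property
    have : IsIso ((restrictedAdjunction hF hG).counit.app E).unop :=
      isIso_of_fully_faithful stonePlusEtale.ι _
    exact (isIso_unop_iff _).1 this
  refine ⟨adjunctionFG, fun A a => rfl, fun E x μ => HausEtale.mem_pointPFun, hF, hG,
    restrictedAdjunction hF hG, fun A => rfl, fun E => rfl, NatIso.isIso_of_isIso_app _,
    NatIso.isIso_of_isIso_app _, ?_, ?_⟩
  · exact (restrictedAdjunction hF hG).toEquivalence.isEquivalence_functor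
  · exact (restrictedAdjunction hF hG).toEquivalence.isEquivalence_inverse
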